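/- A total applicative structure is a set $A$ with a total binary operation $(x,y)\mapsto xy$ (application, associating to the left). A $\mathbf{BII}^{\times}\mathbf{LP}$-algebra is a total applicative structure $A$ containing elements $\mathbf B,\mathbf I,\mathbf I^{\times},\mathbf L,\mathbf P$ and, for each $a\in A$, an element $a^{\circ}$, such that for all $a,x,y,z\in A$ $$\mathbf Bxyz=x(yz),\quad \mathbf Ix=x,\quad a^{\circ}x=xa,\quad \mathbf I^{\times}a\,\mathbf I=a,\quad \mathbf Lx(\mathbf Pyz)=xyz.$$ A bi-$\mathbf{BDI}$-algebra is a total applicative structure $A$ for which there exist a second total binary operation $\triangleright$ on $A$ and elements $\mathbf B_r,\mathbf B_l,\mathbf D_r,\mathbf D_l,\mathbf I_r,\mathbf I_l\in A$ and, for each $a\in A$, elements $a^{\dagger r},a^{\dagger l}\in A$, such that for all $a,x,y,z\in A$ $$\mathbf B_r xyz=x(yz),\quad z\triangleright(y\triangleright(x\triangleright\mathbf B_l))=(z\triangleright y)\triangleright x,\quad x\triangleright(\mathbf D_r yz)=(x\triangleright y)z,\quad (z\triangleright(y\triangleright\mathbf D_l))x=z\triangleright(yx),$$ $$\mathbf I_r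 x=x,\quad x\triangleright\mathbf I_l=x,\quad a^{\dagger r}x=x\triangleright a,\quad x\triangleright a^{\dagger l}=ax.$$ Let $\mathcal F$ be the free $\mathbf{BII}^{\times}\mathbf{LP}$-algebra on two constants $c_1,c_2$: its elements are the formal terms built from $\mathbf B,\mathbf I,\mathbf I^{\times},\mathbf L,\mathbf P,c_1,c_2$ by application and a unary operation $(-)^{\circ}$, modulo the least congruence (for application and $(-)^{\circ}$) generated by the five axioms of $\mathbf{BII}^{\times}\mathbf{LP}$-algebras above; its application is induced by the application of terms. Proposition. The applicative structure $\mathcal F$ is a $\mathbf{BII}^{\times}\mathbf{LP}$-algebra but not a bi-$\mathbf{BDI}$-algebra. Moreover, every bi-$\mathbf{BDI}$-algebra is a $\mathbf{BII}^{\times}\mathbf{LP}$-algebra, and hence the class of bi-$\mathbf{BDI}$-algebras is strictly contained in the class of $\mathbf{BII}^{\times}\mathbf{LP}$-algebras. -/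

import Mathlib

universe u

/-- A total applicative structure: a set with a total binary operation `app x y` (written `x y`). -/
structure ApplicativeStructure : Type (u + 1) where
  carrier : Type u
  app : carrier → carrier → carrier

namespace ApplicativeStructure

/-- `A` is a `BII^×LP`-algebra: it contains elements `B`, `I`, `I^×`, `L`, `P` and, for each `a`,
an element `a°`, such that `B x y z = x (y z)`, `I x = x`, `a° x = x a`, `I^× a I = a` and
`L x (P y z) = x y z`. -/
def IsBIIxLPAlgebra (A : ApplicativeStructure.{u}) : Prop :=
  ∃ B I Ix L P : A.carrier,
    (∀ x y z, A.app (A.app (A.app B x) y) z = A.app x (A.app y z)) ∧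
    (∀ x, A.app I x = x) ∧
    (∀ a, ∃ a' : A.carrier, ∀ x, A.app a' x = A.app x a) ∧
    (∀ a, A.app (A.app Ix a) I = a) ∧
    (∀ x y z, A.app (A.app L x) (A.app (A.app P y) z) = A.app (A.app x y) z)

/-- `A` (whose operation is the right application) is a bi-`BDI`-algebra: there is a further total
binary operation `lapp` on the same set, the left application (`lapp y x` has the argument `y` on
the left and the function `x` on the right), together with the elements
`Br`, `Bl`, `Dr`, `Dl`, `Ir`, `Il`, and `a†` (right and left) for each `a`. -/
def IsBiBDIAlgebra (A : ApplicativeStructure.{u}) : Prop :=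
  ∃ lapp : A.carrier → A.carrier → A.carrier,
    (∃ Br, ∀ x y z, A.app (A.app (A.app Br x) y) z = A.app x (A.app y z)) ∧
    (∃ Bl, ∀ x y z, lapp z (lapp y (lapp x Bl)) = lapp (lapp z y) x) ∧
    (∃ Dr, ∀ x y z, lapp x (A.app (A.app Dr y) z) = A.app (lapp x y) z) ∧
    (∃ Dl, ∀ x y z, A.app (lapp z (lapp y Dl)) x = lapp z (A.app y x)) ∧
    (∃ Ir, ∀ x, A.app Ir x = x) ∧
    (∃ Il, ∀ x, lapp x Il = x) ∧
    (∀ a, ∃ a' : A.carrier, ∀ x, A.app a' x = lapp x a) ∧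
    (∀ a, ∃ a' : A.carrier, ∀ x, lapp x a' = A.app a x)

end ApplicativeStructure

/-- Formal terms built from `B`, `I`, `I^×`, `L`, `P` and two constants by application and the
unary operation `(-)°`. -/
inductive FreeTerm : Type where
  | B : FreeTerm
  | I : FreeTerm
  | Ix : FreeTerm
  | L : FreeTerm
  | P : FreeTerm
  | c₁ : FreeTerm
  | c₂ : FreeTerm
  | app : FreeTerm → FreeTerm → FreeTerm
  | kuro : FreeTerm → FreeTerm

/-- The least congruence (for application and for `(-)°`) containing the axioms of
`BII^×LP`-algebras; there is no axiom on the constants. -/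
inductive FreeTerm.Equal : FreeTerm → FreeTerm → Prop where
  | refl (s) : Equal s s
  | symm {s t} : Equal s t → Equal t s
  | trans {s t v} : Equal s t → Equal t v → Equal s v
  | congr_app {s s' t t'} : Equal s s' → Equal t t' → Equal (.app s t) (.app s' t')
  | congr_kuro {s s'} : Equal s s' → Equal (.kuro s) (.kuro s')
  | ax_B (x y z) : Equal (.app (.app (.app .B x) y) z) (.app x (.app y z))
  | ax_I (x) : Equal (.app .I x) x
  | ax_kuro (a x) : Equal (.app (.kuro a) x) (.app x a)
  | ax_Ix (a) : Equal (.app (.app .Ix a) .I) a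
  | ax_LP (x y z) : Equal (.app (.app .L x) (.app (.app .P y) z)) (.app (.app x y) z)

def FreeTerm.setoid : Setoid FreeTerm where
  r := FreeTerm.Equal
  iseqv := ⟨.refl, .symm, .trans⟩

/-- The free `BII^×LP`-algebra on two constants, as a total applicative structure. -/
def freeBIIxLP : ApplicativeStructure.{0} where
  carrier := Quotient FreeTerm.setoid
  app := Quotient.map₂ FreeTerm.app (fun _ _ h _ _ h' => FreeTerm.Equal.congr_app h h')

namespace ApplicativeStructure

/-! In a bi-`BDI`-algebra some element `T` satisfies `T x y = x ▷ y`. So `T x Il = x`, and each `a`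
has an `a'` with `T x a' = a x`. The free algebra has no such `T`. The axioms preserve the number of
each constant, so `T c₁ Il = c₁` makes `T` constant-free and `T c₂ d = c₁ c₂` keeps `c₂` out of `d`.
The term `T c₂ d` is then `Ordered`, a property preserved by reduction. By confluence it would
reduce to the normal form `c₁ c₂`, which is not ordered. -/

theorem IsBiBDIAlgebra.isBIIxLPAlgebra {A : ApplicativeStructure.{u}} (h : A.IsBiBDIAlgebra) :
    A.IsBIIxLPAlgebra := by
  obtain ⟨lapp, ⟨Br, hBr⟩, -, ⟨Dr, hDr⟩, ⟨Dl, hDl⟩, ⟨Ir, hIr⟩, ⟨Il, hIl⟩, hr, -⟩ := h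
  -- `x ▷ (Dr Il a) = (x ▷ Il) a = x a`.
  have kuro : ∀ a, ∃ a' : A.carrier, ∀ x, A.app a' x = A.app x a := fun a => by
    obtain ⟨a', ha'⟩ := hr (A.app (A.app Dr Il) a)
    exact ⟨a', fun x => by rw [ha', hDr, hIl]⟩
  -- With `w = Il°`: `Ix a Ir = a ▷ (w Ir) = a ▷ (Ir Il) = a`.
  obtain ⟨w, hw⟩ := kuro Il
  obtain ⟨Ix, hIx⟩ := hr (lapp w Dl)
  -- `L x v = x ▷ v`, and the `P` below gives `P y z = Dr (Dr Il y) z`.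
  obtain ⟨L, hL⟩ := hr (lapp Ir Dl)
  refine ⟨Br, Ir, Ix, L, A.app (A.app Br Dr) (A.app Dr Il), hBr, hIr, kuro, fun a => ?_,
    fun x y z => ?_⟩
  · rw [hIx, hDl, hw, hIr, hIl]
  · rw [hL, hDl, hIr, hBr, hDr, hDr, hIl]

/-- In a bi-`BDI`-algebra the left application is represented by an element. -/
theorem IsBiBDIAlgebra.exists_lapp {A : ApplicativeStructure.{u}} (h : A.IsBiBDIAlgebra) :
    ∃ T Il : A.carrier, (∀ x, A.app (A.app T x) Il = x) ∧
      ∀ a, ∃ a' : A.carrier, ∀ x, A.app (A.app T x) a' = A.app a x := by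
  obtain ⟨lapp, -, -, -, ⟨Dl, hDl⟩, ⟨Ir, hIr⟩, ⟨Il, hIl⟩, hr, hl⟩ := h
  obtain ⟨T, hT⟩ := hr (lapp Ir Dl)
  have key : ∀ x y, A.app (A.app T x) y = lapp x y := fun x y => by rw [hT, hDl, hIr]
  refine ⟨T, Il, fun x => by rw [key, hIl], fun a => ?_⟩
  obtain ⟨a', ha'⟩ := hl a
  exact ⟨a', fun x => by rw [key, ha']⟩

/-- The copy of an applicative structure in a higher universe. -/
def lift (A : ApplicativeStructure.{0}) : ApplicativeStructure.{u} where
  carrier := ULift.{u} A.carrier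
  app x y := ⟨A.app x.down y.down⟩

theorem IsBIIxLPAlgebra.lift {A : ApplicativeStructure.{0}} (h : A.IsBIIxLPAlgebra) :
    (ApplicativeStructure.lift.{u} A).IsBIIxLPAlgebra := by
  obtain ⟨B, I, Ix, L, P, hB, hI, hk, hIx, hL⟩ := h
  refine ⟨⟨B⟩, ⟨I⟩, ⟨Ix⟩, ⟨L⟩, ⟨P⟩, fun x y z => congrArg ULift.up (hB _ _ _),
    fun x => congrArg ULift.up (hI _), fun a => ?_, fun a => congrArg ULift.up (hIx _),
    fun x y z => congrArg ULift.up (hL _ _ _)⟩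
  obtain ⟨a', ha'⟩ := hk a.down
  exact ⟨⟨a'⟩, fun x => congrArg ULift.up (ha' _)⟩

theorem IsBiBDIAlgebra.of_lift {A : ApplicativeStructure.{0}}
    (h : (ApplicativeStructure.lift.{u} A).IsBiBDIAlgebra) : A.IsBiBDIAlgebra := by
  obtain ⟨lapp, ⟨Br, hBr⟩, ⟨Bl, hBl⟩, ⟨Dr, hDr⟩, ⟨Dl, hDl⟩, ⟨Ir, hIr⟩, ⟨Il, hIl⟩, hr, hl⟩ := h
  refine ⟨fun x y => (lapp ⟨x⟩ ⟨y⟩).down,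
    ⟨Br.down, fun x y z => congrArg ULift.down (hBr ⟨x⟩ ⟨y⟩ ⟨z⟩)⟩,
    ⟨Bl.down, fun x y z => congrArg ULift.down (hBl ⟨x⟩ ⟨y⟩ ⟨z⟩)⟩,
    ⟨Dr.down, fun x y z => congrArg ULift.down (hDr ⟨x⟩ ⟨y⟩ ⟨z⟩)⟩,
    ⟨Dl.down, fun x y z => congrArg ULift.down (hDl ⟨x⟩ ⟨y⟩ ⟨z⟩)⟩,
    ⟨Ir.down, fun x => congrArg ULift.down (hIr ⟨x⟩)⟩,
    ⟨Il.down, fun x => congrArg ULift.down (hIl ⟨x⟩)⟩, fun a => ?_, fun a => ?_⟩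
  · obtain ⟨a', ha'⟩ := hr ⟨a⟩
    exact ⟨a'.down, fun x => congrArg ULift.down (ha' ⟨x⟩)⟩
  · obtain ⟨a', ha'⟩ := hl ⟨a⟩
    exact ⟨a'.down, fun x => congrArg ULift.down (ha' ⟨x⟩)⟩

end ApplicativeStructure

/-! ### Confluent rewriting and an invariant of reduction -/

namespace FreeTerm

open Relation

/-- One-step reduction: the axioms oriented from left to right, applied to one subterm. -/
inductive Step : FreeTerm → FreeTerm → Prop where
  | appl {s s'} (t) : Step s s' → Step (.app s t) (.app s' t)
  | appr (s) {t t'} : Step t t' → Step (.app s t) (.app s t')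
  | kuro {s s'} : Step s s' → Step (.kuro s) (.kuro s')
  | ax_B (x y z) : Step (.app (.app (.app .B x) y) z) (.app x (.app y z))
  | ax_I (x) : Step (.app .I x) x
  | ax_kuro (a x) : Step (.app (.kuro a) x) (.app x a)
  | ax_Ix (a) : Step (.app (.app .Ix a) .I) a
  | ax_LP (x y z) : Step (.app (.app .L x) (.app (.app .P y) z)) (.app (.app x y) z)

namespace Step

/-- Reduction is linear and without critical pairs, so it is confluent in one step. -/
theorem diamond {a b c : FreeTerm} (hb : Step a b) (hc : Step a c) :
    b = c ∨ ∃ d, Step b d ∧ Step c d := by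
  induction hb generalizing c with
  | @appl s s' t h ih =>
    cases hc with
    | appl _ h' =>
      rcases ih h' with rfl | ⟨d, h₁, h₂⟩
      · exact .inl rfl
      · exact .inr ⟨_, .appl _ h₁, .appl _ h₂⟩
    | appr _ h' => exact .inr ⟨_, .appr _ h', .appl _ h⟩
    | ax_B x y z =>
      cases h with
      | appl _ h =>
        cases h with
        | appl _ h => cases h
        | appr _ h => exact .inr ⟨_, .ax_B _ _ _, .appl _ h⟩
      | appr _ h => exact .inr ⟨_, .ax_B _ _ _, .appr _ (.appl _ h)⟩
    | ax_I => cases h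
    | ax_kuro a x =>
      cases h with
      | kuro h => exact .inr ⟨_, .ax_kuro _ _, .appr _ h⟩
    | ax_Ix a =>
      cases h with
      | appl _ h => cases h
      | appr _ h => exact .inr ⟨_, .ax_Ix _, h⟩
    | ax_LP x y z =>
      cases h with
      | appl _ h => cases h
      | appr _ h => exact .inr ⟨_, .ax_LP _ _ _, .appl _ (.appl _ h)⟩
  | @appr s t t' h ih =>
    cases hc with
    | appl _ h' => exact .inr ⟨_, .appl _ h', .appr _ h⟩
    | appr _ h' =>
      rcases ih h' with rfl | ⟨d, h₁, h₂⟩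
      · exact .inl rfl
      · exact .inr ⟨_, .appr _ h₁, .appr _ h₂⟩
    | ax_B x y z => exact .inr ⟨_, .ax_B _ _ _, .appr _ (.appr _ h)⟩
    | ax_I => exact .inr ⟨_, .ax_I _, h⟩
    | ax_kuro a x => exact .inr ⟨_, .ax_kuro _ _, .appl _ h⟩
    | ax_Ix a => cases h
    | ax_LP x y z =>
      cases h with
      | appl _ h =>
        cases h with
        | appl _ h => cases h
        | appr _ h => exact .inr ⟨_, .ax_LP _ _ _, .appl _ (.appr _ h)⟩
      | appr _ h => exact .inr ⟨_, .ax_LP _ _ _, .appr _ h⟩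
  | kuro h ih =>
    cases hc with
    | kuro h' =>
      rcases ih h' with rfl | ⟨d, h₁, h₂⟩
      · exact .inl rfl
      · exact .inr ⟨_, .kuro h₁, .kuro h₂⟩
  | ax_B x y z =>
    cases hc with
    | appl _ h =>
      cases h with
      | appl _ h =>
        cases h with
        | appl _ h => cases h
        | appr _ h => exact .inr ⟨_, .appl _ h, .ax_B _ _ _⟩
      | appr _ h => exact .inr ⟨_, .appr _ (.appl _ h), .ax_B _ _ _⟩
    | appr _ h => exact .inr ⟨_, .appr _ (.appr _ h), .ax_B _ _ _⟩
    | ax_B => exact .inl rfl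
  | ax_I x =>
    cases hc with
    | appl _ h => cases h
    | appr _ h => exact .inr ⟨_, h, .ax_I _⟩
    | ax_I => exact .inl rfl
  | ax_kuro a x =>
    cases hc with
    | appl _ h =>
      cases h with
      | kuro h => exact .inr ⟨_, .appr _ h, .ax_kuro _ _⟩
    | appr _ h => exact .inr ⟨_, .appl _ h, .ax_kuro _ _⟩
    | ax_kuro => exact .inl rfl
  | ax_Ix a =>
    cases hc with
    | appl _ h =>
      cases h with
      | appl _ h => cases h
      | appr _ h => exact .inr ⟨_, h, .ax_Ix _⟩
    | appr _ h => cases h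
    | ax_Ix => exact .inl rfl
  | ax_LP x y z =>
    cases hc with
    | appl _ h =>
      cases h with
      | appl _ h => cases h
      | appr _ h => exact .inr ⟨_, .appl _ (.appl _ h), .ax_LP _ _ _⟩
    | appr _ h =>
      cases h with
      | appl _ h =>
        cases h with
        | appl _ h => cases h
        | appr _ h => exact .inr ⟨_, .appl _ (.appr _ h), .ax_LP _ _ _⟩
      | appr _ h => exact .inr ⟨_, .appr _ h, .ax_LP _ _ _⟩
    | ax_LP => exact .inl rfl

theorem confluent {a b c : FreeTerm} (hb : ReflTransGen Step a b) (hc : ReflTransGen Step a c) :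
    Join (ReflTransGen Step) b c := by
  refine church_rosser (fun a b c hb hc => ?_) hb hc
  rcases diamond hb hc with rfl | ⟨d, h₁, h₂⟩
  · exact ⟨_, .refl, .refl⟩
  · exact ⟨d, .single h₁, .single h₂⟩

end Step

theorem Equal.join {s t : FreeTerm} (h : Equal s t) : Join (ReflTransGen Step) s t := by
  induction h with
  | refl s => exact ⟨s, .refl, .refl⟩
  | symm _ ih => exact ih.imp fun _ h => h.symm
  | trans _ _ ih₁ ih₂ =>
    obtain ⟨d, h₁, h₂⟩ := ih₁
    obtain ⟨e, h₃, h₄⟩ := ih₂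
    obtain ⟨f, h₅, h₆⟩ := Step.confluent h₂ h₃
    exact ⟨f, h₁.trans h₅, h₄.trans h₆⟩
  | @congr_app s s' t t' _ _ ih₁ ih₂ =>
    obtain ⟨d, h₁, h₂⟩ := ih₁
    obtain ⟨e, h₃, h₄⟩ := ih₂
    exact ⟨.app d e,
      (h₁.lift (FreeTerm.app · t) fun _ _ => .appl _).trans (h₃.lift _ fun _ _ => .appr d),
      (h₂.lift (FreeTerm.app · t') fun _ _ => .appl _).trans (h₄.lift _ fun _ _ => .appr d)⟩
  | congr_kuro _ ih =>
    obtain ⟨d, h₁, h₂⟩ := ih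
    exact ⟨.kuro d, h₁.lift _ fun _ _ => .kuro, h₂.lift _ fun _ _ => .kuro⟩
  | ax_B x y z => exact ⟨_, .single (.ax_B x y z), .refl⟩
  | ax_I x => exact ⟨_, .single (.ax_I x), .refl⟩
  | ax_kuro a x => exact ⟨_, .single (.ax_kuro a x), .refl⟩
  | ax_Ix a => exact ⟨_, .single (.ax_Ix a), .refl⟩
  | ax_LP x y z => exact ⟨_, .single (.ax_LP x y z), .refl⟩

/-- The number of occurrences of `c₁`. -/
def count₁ : FreeTerm → ℕ
  | c₁ => 1
  | app s t => count₁ s + count₁ t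
  | kuro s => count₁ s
  | _ => 0

/-- The number of occurrences of `c₂`. -/
def count₂ : FreeTerm → ℕ
  | c₂ => 1
  | app s t => count₂ s + count₂ t
  | kuro s => count₂ s
  | _ => 0

/-- Each axiom is linear: every variable occurs exactly once on both sides. -/
theorem Equal.count₁_eq {s t : FreeTerm} (h : Equal s t) : count₁ s = count₁ t := by
  induction h <;> (try simp only [count₁]) <;> omega

theorem Equal.count₂_eq {s t : FreeTerm} (h : Equal s t) : count₂ s = count₂ t := by
  induction h <;> (try simp only [count₂]) <;> omega

theorem Step.equal {s t : FreeTerm} (h : Step s t) : Equal s t := by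
  induction h with
  | appl t _ ih => exact .congr_app ih (.refl t)
  | appr s _ ih => exact .congr_app (.refl s) ih
  | kuro _ ih => exact .congr_kuro ih
  | ax_B => exact .ax_B ..
  | ax_I => exact .ax_I ..
  | ax_kuro => exact .ax_kuro ..
  | ax_Ix => exact .ax_Ix ..
  | ax_LP => exact .ax_LP ..

/-- No `c₂` occurs under `(-)°`, and no `c₁` occurs to the left of a `c₂`. -/
def Ordered : FreeTerm → Prop
  | app s t => Ordered s ∧ Ordered t ∧ (count₁ s = 0 ∨ count₂ t = 0)
  | kuro s => count₂ s = 0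
  | _ => True

theorem ordered_of_count₂_eq_zero {s : FreeTerm} (h : count₂ s = 0) : Ordered s := by
  induction s with
  | app s t ihs iht =>
    simp only [count₂, Nat.add_eq_zero_iff] at h
    exact ⟨ihs h.1, iht h.2, .inr h.2⟩
  | kuro s => exact h
  | _ => trivial

/-- Only the rule for `(-)°` changes the left-to-right order of arguments, and the argument it moves
to the right contains no `c₂`. The converse fails: `c₁° c₂` is not ordered but reduces to `c₂ c₁`.
Hence the need for confluence. -/
theorem Ordered.step {s t : FreeTerm} (hs : Ordered s) (h : Step s t) : Ordered t := by
  induction h with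
  | appl t h ih => exact ⟨ih hs.1, hs.2.1, h.equal.count₁_eq ▸ hs.2.2⟩
  | appr s h ih => exact ⟨hs.1, ih hs.2.1, h.equal.count₂_eq ▸ hs.2.2⟩
  | kuro h => exact h.equal.count₂_eq.symm.trans hs
  | ax_B x y z =>
    simp only [Ordered, count₁, count₂] at hs ⊢
    refine ⟨hs.1.1.2.1, ⟨hs.1.2.1, hs.2.1, ?_⟩, ?_⟩ <;> omega
  | ax_I x => exact hs.2.1
  | ax_kuro a x => exact ⟨hs.2.1, ordered_of_count₂_eq_zero hs.1, .inr hs.1⟩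
  | ax_Ix a => exact hs.1.2.1
  | ax_LP x y z =>
    simp only [Ordered, count₁, count₂] at hs ⊢
    refine ⟨⟨hs.1.2.1, hs.2.1.1.2.1, ?_⟩, hs.2.1.2.1, ?_⟩ <;> omega

theorem Ordered.reflTransGen {s t : FreeTerm} (hs : Ordered s) (h : ReflTransGen Step s t) :
    Ordered t := by
  induction h with
  | refl => exact hs
  | tail _ h ih => exact ih.step h

theorem not_step_app_c₁_c₂ (t : FreeTerm) : ¬ Step (.app .c₁ .c₂) t := by
  intro h
  cases h with
  | appl _ h => cases h
  | appr _ h => cases h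

theorem not_equal_app_c₁_c₂_of_ordered {s : FreeTerm} (hs : Ordered s) :
    ¬ Equal s (.app .c₁ .c₂) := by
  intro h
  obtain ⟨d, h₁, h₂⟩ := h.join
  -- `c₁ c₂` is normal, so the common reduct is `c₁ c₂` itself.
  rcases h₂.cases_head with rfl | ⟨e, he, -⟩
  · simpa [Ordered, count₁, count₂] using hs.reflTransGen h₁
  · exact not_step_app_c₁_c₂ e he

end FreeTerm

/-! ### The free algebra and the strict inclusion -/

open FreeTerm in
theorem freeBIIxLP_isBIIxLPAlgebra : freeBIIxLP.IsBIIxLPAlgebra := by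
  refine ⟨Quotient.mk _ .B, Quotient.mk _ .I, Quotient.mk _ .Ix, Quotient.mk _ .L,
    Quotient.mk _ .P, ?_, ?_, ?_, ?_, ?_⟩
  · rintro ⟨x⟩ ⟨y⟩ ⟨z⟩
    exact Quotient.sound (Equal.ax_B x y z)
  · rintro ⟨x⟩
    exact Quotient.sound (Equal.ax_I x)
  · rintro ⟨a⟩
    refine ⟨Quotient.mk _ (.kuro a), ?_⟩
    rintro ⟨x⟩
    exact Quotient.sound (Equal.ax_kuro a x)
  · rintro ⟨a⟩
    exact Quotient.sound (Equal.ax_Ix a)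
  · rintro ⟨x⟩ ⟨y⟩ ⟨z⟩
    exact Quotient.sound (Equal.ax_LP x y z)

open FreeTerm in
theorem freeBIIxLP_not_isBiBDIAlgebra : ¬ freeBIIxLP.IsBiBDIAlgebra := by
  intro h
  obtain ⟨⟨T⟩, ⟨J⟩, hJ, hl⟩ := h.exists_lapp
  obtain ⟨⟨d⟩, hd⟩ := hl (Quotient.mk _ .c₁)
  have e₁ : Equal (.app (.app T .c₁) J) .c₁ := Quotient.exact (hJ (Quotient.mk _ .c₁))
  have e₂ : Equal (.app (.app T .c₂) d) (.app .c₁ .c₂) :=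
    Quotient.exact (hd (Quotient.mk _ .c₂))
  have n₁ := e₁.count₁_eq
  have n₂ := e₁.count₂_eq
  have n₃ := e₂.count₂_eq
  simp only [count₁, count₂] at n₁ n₂ n₃
  refine not_equal_app_c₁_c₂_of_ordered ?_ e₂
  -- The counts leave no constant in `T` and no `c₂` in `d`.
  refine ⟨⟨ordered_of_count₂_eq_zero (by omega), trivial, .inl (by omega)⟩,
    ordered_of_count₂_eq_zero (by omega), .inr (by omega)⟩

theorem mainTheorem8 :
    freeBIIxLP.IsBIIxLPAlgebra ∧
    ¬ freeBIIxLP.IsBiBDIAlgebra ∧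
    {A : ApplicativeStructure.{u} | A.IsBiBDIAlgebra} ⊂
      {A : ApplicativeStructure.{u} | A.IsBIIxLPAlgebra} :=
  ⟨freeBIIxLP_isBIIxLPAlgebra, freeBIIxLP_not_isBiBDIAlgebra,
    fun _ h => ApplicativeStructure.IsBiBDIAlgebra.isBIIxLPAlgebra h,
    -- The free algebra lives in universe `0`, so its lifted copy separates the classes in universe
    -- `u`.
    fun h => freeBIIxLP_not_isBiBDIAlgebra
      (h freeBIIxLP_isBIIxLPAlgebra.lift : (ApplicativeStructure.lift _).IsBiBDIAlgebra).of_lift⟩
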